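/- **Theorem 3.4.** Formulas are built from countably many propositional variables and $\top$ with $\land,\lor,\to,\neg$. Let $\mathsf N$ be positive logic (the positive fragment of intuitionistic logic) with the additional axiom $(p\leftrightarrow q)\to(\neg p\leftrightarrow\neg q)$, and let $\mathsf{MPC}$ be positive logic with the additional axiom $(p\to q)\land(p\to\neg q)\to\neg p$. An *N-logic* is a set $L$ of formulas, closed under modus ponens and uniform substitution, with $\mathsf N\subseteq L\subseteq\mathsf{MPC}$ (logics are identified with their sets of theorems). For a set $S$ of formulas, $\mathsf N+S$ is the least set of formulas that contains $\mathsf N\cup S$ and is closed under modus ponens and uniform substitution. For $n\in\mathbb N$ let $\mathfrak F_n$ be the finite poset with nodes $r_n$ (root), $x_0,\dots,x_{n+2}$, $y_0,\dots,y_{n+1}$ and $t_n$ (top), whose order is generated by $x_{i+1}<x_i$ ($0\le i\le n+1$); $y_{i+1}<y_i$ and $y_{i+1}<x_i$ ($0\le i\le n$); $x_{i+1}<y_i$ ($1\le i\le n$); $r_n<x_{n+2}$, $r_n<y_{n+1}$; $x_0<t_n$, $y_0<t_n$. Take one variable $p_v$ for each node $v$ of $\mathfrak F_n$ and let $p_v$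 be true exactly at the nodes $u\ge v$. For a node $w$ let $\mathrm{prop}(w)$ be the set of the variables $p_v$ true at $w$, let $w_1,\dots,w_r$ be the immediate successors of $w$, and let $\mathrm{newprop}(w)$ be the set of the $p_v$ that are false at $w$ and true at all of $w_1,\dots,w_r$. Define by recursion from the top $\varphi^\star_{t_n}=\bigwedge\mathrm{prop}(t_n)$ and, for $w\neq t_n$, $$\varphi^\star_w=\bigwedge\mathrm{prop}(w)\land\Bigl(\bigvee\mathrm{newprop}(w)\lor\bigvee_{w_i\ne t_n}\psi^\star_{w_i}\to\bigvee_{i=1}^r\varphi^\star_{w_i}\Bigr),\qquad \psi^\star_w=\varphi^\star_w\to\bigvee_{i=1}^r\varphi^\star_{w_i}.$$ With $p$ a fresh variable and with $w_1,\dots,w_r$ now the immediate successors of the root $r_n$, put $$\theta(\mathfrak F_n)=(p\to\neg p)\land\varphi^\star_{r_n}\to\neg p\lor\bigvee_{i=1}^r\varphi^\star_{w_i}.$$ Then: 1. $\{\mathfrak F_n\mid n\in\mathbb N\}$ is a $\le$-antichain: for $n\ne m$ there is no order-preserving map from $\mathfrak F_m$ onto $\mathfrak F_n$. 2. Each $\theta(\mathfrak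 F_n)$ is a theorem of $\mathsf{MPC}$. 3. For each $\Gamma\subseteq\mathbb N$, $L(\Gamma)=\mathsf N+\{\theta(\mathfrak F_n)\mid n\in\Gamma\}$ is an N-logic. 4. If $\Gamma_1\ne\Gamma_2$ then $L(\Gamma_1)\ne L(\Gamma_2)$. 5. The set of all N-logics (the lattice of logics between $\mathsf N$ and $\mathsf{MPC}$, ordered by inclusion) has the cardinality of the continuum, $2^{\aleph_0}$. -/

import Mathlib

namespace NLogics

/-- Formulas of the language of minimal logic over the countable set `ℕ` of variables
(there is no falsum in the language). -/
inductive Formula : Type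
  | var : ℕ → Formula
  | top : Formula
  | and : Formula → Formula → Formula
  | or : Formula → Formula → Formula
  | imp : Formula → Formula → Formula
  | neg : Formula → Formula

namespace Formula

/-- `a ↔ b` is an abbreviation of `(a → b) ∧ (b → a)`. -/
def iff (a b : Formula) : Formula := (a.imp b).and (b.imp a)

/-- Uniform substitution. -/
def subst (s : ℕ → Formula) : Formula → Formula
  | var i => s i
  | top => top
  | and a b => (subst s a).and (subst s b)
  | or a b => (subst s a).or (subst s b)
  | imp a b => (subst s a).imp (subst s b)
  | neg a => (subst s a).neg

/-- Finite conjunction; the empty one is `⊤`. -/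
def conj : List Formula → Formula
  | [] => top
  | [a] => a
  | a :: b :: l => a.and (conj (b :: l))

/-- Finite disjunction. The language has no falsum, so the value at `[]` is a convention;
the disjunctions that occur in the formulas `theta n` below are nonempty. -/
def disj : List Formula → Formula
  | [] => top
  | [a] => a
  | a :: b :: l => a.or (disj (b :: l))

end Formula

open Formula in
/-- The axioms of positive logic. -/
inductive PosAxiom : Formula → Prop
  | k (a b : Formula) : PosAxiom (a.imp (b.imp a))
  | s (a b c : Formula) :
      PosAxiom ((a.imp (b.imp c)).imp ((a.imp b).imp (a.imp c)))
  | andLeft (a b : Formula) : PosAxiom ((a.and b).imp a)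
  | andRight (a b : Formula) : PosAxiom ((a.and b).imp b)
  | andIntro (a b : Formula) : PosAxiom (a.imp (b.imp (a.and b)))
  | orLeft (a b : Formula) : PosAxiom (a.imp (a.or b))
  | orRight (a b : Formula) : PosAxiom (b.imp (a.or b))
  | orElim (a b c : Formula) :
      PosAxiom ((a.imp c).imp ((b.imp c).imp ((a.or b).imp c)))
  | topIntro : PosAxiom top

/-- Derivability in the system that extends positive logic by the axioms in `S`, with the rules of
modus ponens and uniform substitution. -/
inductive Derivable (S : Set Formula) : Formula → Prop
  | pos {a : Formula} : PosAxiom a → Derivable S a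
  | ax {a : Formula} : a ∈ S → Derivable S a
  | mp {a b : Formula} : Derivable S (a.imp b) → Derivable S a → Derivable S b
  | subst {a : Formula} (s : ℕ → Formula) : Derivable S a → Derivable S (a.subst s)

/-- The set of theorems of positive logic plus the axioms in `S`. -/
def posPlus (S : Set Formula) : Set Formula := {a | Derivable S a}

/-- `(p ↔ q) → (¬p ↔ ¬q)`. -/
def axN : Formula :=
  ((Formula.var 0).iff (Formula.var 1)).imp ((Formula.var 0).neg.iff (Formula.var 1).neg)

/-- `(p → q) ∧ (p → ¬q) → ¬p`. -/
def axMPC : Formula :=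
  (((Formula.var 0).imp (Formula.var 1)).and ((Formula.var 0).imp (Formula.var 1).neg)).imp
    (Formula.var 0).neg

/-- The basic logic `N`, as its set of theorems. -/
def logicN : Set Formula := posPlus {axN}

/-- Minimal logic `MPC`, as its set of theorems. -/
def logicMPC : Set Formula := posPlus {axMPC}

/-- The logic `N + S`. -/
def logicNPlus (S : Set Formula) : Set Formula := posPlus ({axN} ∪ S)

/-- An N-logic: a set of formulas closed under modus ponens and uniform substitution,
between `N` and `MPC`. -/
structure IsNLogic (L : Set Formula) : Prop where
  mp : ∀ a b : Formula, a.imp b ∈ L → a ∈ L → b ∈ L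
  subst : ∀ (s : ℕ → Formula) (a : Formula), a ∈ L → a.subst s ∈ L
  logicN_subset : logicN ⊆ L
  subset_logicMPC : L ⊆ logicMPC

/-- `F` is an order-preserving image of `G`. -/
def IsOrderImage (F G : Type*) [PartialOrder F] [PartialOrder G] : Prop :=
  ∃ f : G → F, Monotone f ∧ Function.Surjective f

/-- The nodes of the poset `𝔉_n`: a root, `x_0, …, x_{n+2}`, `y_0, …, y_{n+1}`, and a top node. -/
inductive Node (n : ℕ) : Type
  | root : Node n
  | x : Fin (n + 3) → Node n
  | y : Fin (n + 2) → Node n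
  | top : Node n
  deriving DecidableEq, Fintype

namespace Node

variable {n : ℕ}

/-- The order of `𝔉_n`. It is the one generated by
`x_{i+1} < x_i` (for `0 ≤ i ≤ n + 1`), `y_{i+1} < y_i`, `y_{i+1} < x_i` (for `0 ≤ i ≤ n`),
`x_{i+1} < y_i` (for `1 ≤ i ≤ n`), with the root below `x_{n+2}`, `y_{n+1}`
and the top above `x_0`, `y_0`. -/
def le : Node n → Node n → Prop
  | root, _ => True
  | _, top => True
  | x i, x j => (j : ℕ) ≤ i
  | y i, y j => (j : ℕ) ≤ i
  | y i, x j => (j : ℕ) < i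
  | x i, y j => 1 ≤ n ∧ 2 ≤ (i : ℕ) ∧ (j : ℕ) < i ∧ (j : ℕ) ≤ n
  | x _, root => False
  | y _, root => False
  | top, root => False
  | top, x _ => False
  | top, y _ => False

instance : PartialOrder (Node n) where
  le := le
  le_refl a := by cases a <;> simp [le]
  le_trans a b c hab hbc := by
    cases a <;> cases b <;> cases c <;> simp only [le] at * <;> omega
  le_antisymm a b hab hba := by
    cases a <;> cases b <;> simp only [le, x.injEq, y.injEq, Fin.ext_iff] at * <;> omega

instance : OrderBot (Node n) where
  bot := root
  bot_le _ := trivial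

instance : OrderTop (Node n) where
  top := top
  le_top a := by cases a <;> exact trivial

/-- Numbering of the nodes of `𝔉_n` by `1, …, 2n + 7`. -/
def code : Node n → ℕ
  | root => 1
  | top => 2
  | x i => 2 * i + 3
  | y i => 2 * i + 4

end Node

section JankovDeJongh

variable {W : Type*} [PartialOrder W] [Fintype W]

open Classical in
/-- The variables from `P` true at `w` under the valuation `V`, in a list. -/
noncomputable def propVars (P : Finset ℕ) (V : ℕ → UpperSet W) (w : W) : List Formula :=
  (P.filter fun i => w ∈ V i).toList.map Formula.var

open Classical in
/-- The variables from `P` false at `w` but true at all immediate successors of `w`, in a list. -/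
noncomputable def newPropVars (P : Finset ℕ) (V : ℕ → UpperSet W) (w : W) : List Formula :=
  (P.filter fun i => w ∉ V i ∧ ∀ v, w ⋖ v → v ∈ V i).toList.map Formula.var

/-- The list of the immediate successors of `w`. -/
noncomputable def covers (w : W) : List {v : W // w ⋖ v} :=
  open Classical in (Finset.univ : Finset {v : W // w ⋖ v}).toList

/-- One step of the recursion, from the top downwards, that defines the pair `(φ_w, ψ_w)`
from the pairs of the nodes above `w`. With `w₁, …, w_r` the immediate successors of `w`,
`φ_w = ⋀ prop(w) ∧ (⋁ newprop(w) ∨ ⋁ ψ_{w_i} → ⋁ φ_{w_i})` and `ψ_w = φ_w → ⋁ φ_{w_i}`,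
where there is no disjunct `ψ_{w_i}` if `w_i` is the top node.
At the top node, `φ` is `⋀ prop(⊤)` and `ψ` is not used. -/
noncomputable def jankovStep [OrderTop W] (P : Finset ℕ) (V : ℕ → UpperSet W)
    (w : W) (ih : ∀ v : W, v > w → Formula × Formula) : Formula × Formula :=
  open Classical in
  if w = ⊤ then (Formula.conj (propVars P V w), Formula.top)
  else
    let succPhi : Formula := Formula.disj ((covers w).map fun v => (ih v.1 v.2.lt).1)
    let succPsi : List Formula :=
      ((covers w).filter fun v => v.1 ≠ ⊤).map fun v => (ih v.1 v.2.lt).2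
    let phi : Formula :=
      (Formula.conj (propVars P V w)).and
        ((Formula.disj (newPropVars P V w ++ succPsi)).imp succPhi)
    (phi, phi.imp succPhi)

/-- The pair `(φ_w, ψ_w)` of positive de Jongh formulas of the node `w` of the finite model
`(W, V)` with a top node, in the variables from `P`. -/
noncomputable def jankovPair [OrderTop W] (P : Finset ℕ) (V : ℕ → UpperSet W) :
    W → Formula × Formula :=
  IsWellFounded.fix (· > ·) (jankovStep P V)

/-- The formula `φ_w`. -/
noncomputable def phiStar [OrderTop W] (P : Finset ℕ) (V : ℕ → UpperSet W) (w : W) : Formula :=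
  (jankovPair P V w).1

end JankovDeJongh

/-- The valuation on `𝔉_n` that makes the variable with the number of the node `v` true
exactly at the nodes above `v`. All nodes of `𝔉_n` get different sets of variables,
and all variables with numbers `1, …, 2n + 7` are true at the top node. -/
def frameVal (n : ℕ) (i : ℕ) : UpperSet (Node n) where
  carrier := {u | ∃ v : Node n, v.code = i ∧ v ≤ u}
  upper' := fun _ _ huw ⟨v, hv, hvu⟩ => ⟨v, hv, hvu.trans huw⟩

/-- The formula `φ_w` of a node `w` of `𝔉_n`, in the variables `1, …, 2n + 7`. -/
noncomputable def framePhi (n : ℕ) (w : Node n) : Formula :=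
  phiStar (Finset.Icc 1 (2 * n + 7)) (frameVal n) w

/-- `θ(𝔉_n) = (p → ¬p) ∧ φ_w → ¬p ∨ ⋁ φ_{w_i}`, with `w` the root of `𝔉_n`, `w_1, …, w_r` the
immediate successors of `w`, and the fresh variable `p` with number `0`. -/
noncomputable def theta (n : ℕ) : Formula :=
  (((Formula.var 0).imp (Formula.var 0).neg).and (framePhi n ⊥)).imp
    ((Formula.var 0).neg.or
      (Formula.disj ((covers (⊥ : Node n)).map fun v => framePhi n v.1)))

end NLogics

/-!
Reading `¬a` as `a` validates the axiom of `N` trivially, and it turns `θ(𝔉_n)` into a positive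
formula equivalent to `φ_r → p ∨ ⋁ φ_{w_i}`, with `r` the root of `𝔉_n`, `w_i` its covers, and `p`
a fresh variable. So ordinary Kripke models for positive logic, with negation as the identity
(`Forces`), suffice to separate the logics.

The formulas `φ_w` describe the nodes of `𝔉_n`. In the model on `𝔉_n` itself, `φ_w` is true exactly
above `w` (`forces_phiStar_self`), so the root refutes `θ(𝔉_n)`. Conversely, let a node of an
arbitrary model force `φ_r` but none of the `φ_{w_i}`. Each node above it then forces `φ_v`
exactly for the `v` below one node `w`, its type (`HasType.forces_iff`), and all nodes of `𝔉_n` but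
possibly the top one occur as types (`HasType.exists_of_le`). Mapping nodes to their types is
monotone, and it is onto `𝔉_n` if the model has a top node (`HasType.isOrderImage`). Hence a model
on `𝔉_m` that refutes `θ(𝔉_n)` makes `𝔉_n` an order-preserving image of `𝔉_m`.

By `Node.not_isOrderImage` this happens only for `m = n`: a monotone surjection reflects
incomparability, and the incomparable pairs of `𝔉_n` leave it no freedom. Therefore
`N + {θ(𝔉_n) : n ∈ Γ}` contains `θ(𝔉_n)` only for `n ∈ Γ`. In `MPC` all the formulas `θ(𝔉_n)` are
provable since `(p → ¬p) → ¬p` is. This gives as many N-logics as there are sets of natural numbers,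
and there are no more sets of formulas than that.
-/

namespace NLogics

/-! ### Derivations in extensions of positive logic -/

namespace Derivable

variable {S T : Set Formula} {a b c g : Formula}

theorem imp_const (h : Derivable S b) : Derivable S (a.imp b) :=
  .mp (.pos (.k b a)) h

theorem imp_mp (h₁ : Derivable S (g.imp (a.imp b))) (h₂ : Derivable S (g.imp a)) :
    Derivable S (g.imp b) :=
  .mp (.mp (.pos (.s g a b)) h₁) h₂

theorem imp_trans (h₁ : Derivable S (a.imp b)) (h₂ : Derivable S (b.imp c)) :
    Derivable S (a.imp c) :=
  imp_mp (imp_const h₂) h₁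

theorem imp_refl (a : Formula) : Derivable S (a.imp a) :=
  imp_mp (b := a) (.pos (.k a (a.imp a))) (.pos (.k a a))

theorem imp_and (h₁ : Derivable S (g.imp a)) (h₂ : Derivable S (g.imp b)) :
    Derivable S (g.imp (a.and b)) :=
  imp_mp (imp_trans h₁ (.pos (.andIntro a b))) h₂

theorem curry (h : Derivable S ((g.and a).imp b)) : Derivable S (g.imp (a.imp b)) :=
  imp_trans (.pos (.andIntro g a)) (.mp (.pos (.s a (g.and a) b)) (imp_const h))

theorem of_forall_axiom (h : ∀ a ∈ S, Derivable T a) (ha : Derivable S a) : Derivable T a := by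
  induction ha with
  | pos h => exact .pos h
  | ax h' => exact h _ h'
  | mp _ _ h₁ h₂ => exact .mp h₁ h₂
  | subst s _ h => exact .subst s h

/-- The axiom of `MPC` for arbitrary formulas, below a premise `g`. -/
theorem imp_neg_of_mpc (h₁ : Derivable {axMPC} (g.imp (a.imp b)))
    (h₂ : Derivable {axMPC} (g.imp (a.imp b.neg))) : Derivable {axMPC} (g.imp a.neg) :=
  imp_trans (imp_and h₁ h₂)
    (.subst (fun i => if i = 0 then a else b) (.ax (Set.mem_singleton axMPC)))

/-- If `g` implies `b → a`, then `g` implies `¬a → ¬b` in `MPC`. -/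
theorem contrapose_of_mpc (h : Derivable {axMPC} (g.imp (b.imp a))) :
    Derivable {axMPC} (g.imp (a.neg.imp b.neg)) :=
  curry <| imp_neg_of_mpc (imp_trans (.pos (.andLeft _ _)) h)
    (imp_trans (.pos (.andRight _ _)) (.pos (.k _ _)))

end Derivable

theorem axN_mem_logicMPC : axN ∈ logicMPC :=
  Derivable.imp_and (.contrapose_of_mpc (.pos (.andRight _ _)))
    (.contrapose_of_mpc (.pos (.andLeft _ _)))

theorem theta_mem_logicMPC (n : ℕ) : theta n ∈ logicMPC :=
  .imp_trans (.pos (.andLeft _ _)) <| .imp_trans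
    (.imp_neg_of_mpc (.imp_const (.imp_refl _)) (.imp_refl _)) (.pos (.orLeft _ _))

theorem isNLogic_logicNPlus {S : Set Formula} (hS : S ⊆ logicMPC) :
    IsNLogic (logicNPlus S) where
  mp _ _ := .mp
  subst s _ := .subst s
  logicN_subset _ := Derivable.of_forall_axiom fun _ h => .ax (.inl h)
  subset_logicMPC _ := Derivable.of_forall_axiom fun a h => by
    rcases h with rfl | h
    exacts [axN_mem_logicMPC, hS h]

/-! ### Kripke models in which negation is the identity -/

section Forcing

variable {W : Type*} [PartialOrder W]

/-- Forcing in the Kripke model `(W, U)`, with `¬a` interpreted as `a`. For positive formulas this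
is the usual intuitionistic forcing relation. -/
def Forces (U : ℕ → UpperSet W) : W → Formula → Prop
  | w, .var i => w ∈ U i
  | _, .top => True
  | w, .and a b => Forces U w a ∧ Forces U w b
  | w, .or a b => Forces U w a ∨ Forces U w b
  | w, .imp a b => ∀ u, w ≤ u → Forces U u a → Forces U u b
  | w, .neg a => Forces U w a

theorem Forces.mono {U : ℕ → UpperSet W} {a : Formula} {w u : W} (hwu : w ≤ u)
    (h : Forces U w a) : Forces U u a := by
  induction a with
  | var i => exact (U i).upper hwu h
  | top => trivial
  | and a b iha ihb => exact ⟨iha h.1, ihb h.2⟩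
  | or a b iha ihb => exact h.imp iha ihb
  | imp a b => exact fun v hv => h v (hwu.trans hv)
  | neg a ih => exact ih h

theorem forces_subst (U : ℕ → UpperSet W) (s : ℕ → Formula) (a : Formula) (w : W) :
    Forces U w (a.subst s) ↔
      Forces (fun i => ⟨{u | Forces U u (s i)}, fun _ _ => Forces.mono⟩) w a := by
  induction a generalizing w with
  | var i => rfl
  | top => rfl
  | and a b iha ihb => exact and_congr (iha w) (ihb w)
  | or a b iha ihb => exact or_congr (iha w) (ihb w)
  | imp a b iha ihb =>
    exact forall_congr' fun u => imp_congr_right fun _ => imp_congr (iha u) (ihb u)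
  | neg a ih => exact ih w

theorem PosAxiom.forces {a : Formula} (h : PosAxiom a) (U : ℕ → UpperSet W) (w : W) :
    Forces U w a := by
  cases h with
  | k a b => exact fun u _ ha v huv _ => ha.mono huv
  | s a b c =>
    exact fun u _ h₁ v huv h₂ x hvx ha =>
      h₁ x (huv.trans hvx) ha x le_rfl (h₂ x hvx ha)
  | andLeft a b => exact fun _ _ h => h.1
  | andRight a b => exact fun _ _ h => h.2
  | andIntro a b => exact fun u _ ha v huv hb => ⟨ha.mono huv, hb⟩
  | orLeft a b => exact fun _ _ => .inl
  | orRight a b => exact fun _ _ => .inr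
  | orElim a b c =>
    exact fun u _ h₁ v huv h₂ x hvx h =>
      h.elim (h₁ x (huv.trans hvx)) (h₂ x hvx)
  | topIntro => trivial

theorem Derivable.forces {S : Set Formula} {a : Formula} (ha : Derivable S a)
    (hS : ∀ b ∈ S, ∀ (U : ℕ → UpperSet W) (w : W), Forces U w b) (U : ℕ → UpperSet W) (w : W) :
    Forces U w a := by
  induction ha generalizing U w with
  | pos h => exact h.forces U w
  | ax h => exact hS _ h U w
  | mp _ _ h₁ h₂ => exact h₁ U w w le_rfl (h₂ U w)
  | subst s _ h => exact (forces_subst U s _ w).2 (h _ w)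

theorem forces_axN (U : ℕ → UpperSet W) (w : W) : Forces U w axN := fun _ _ h => h

theorem forces_conj_map_var (U : ℕ → UpperSet W) (w : W) (l : List ℕ) :
    Forces U w (Formula.conj (l.map .var)) ↔ ∀ i ∈ l, w ∈ U i := by
  induction l with
  | nil => simp [Formula.conj, Forces]
  | cons i l ih =>
    cases l with
    | nil => simp [Formula.conj, Forces]
    | cons j l => simpa [Formula.conj, Forces] using and_congr_right fun _ => ih

theorem forces_disj (U : ℕ → UpperSet W) (w : W) {l : List Formula} (hl : l ≠ []) :
    Forces U w (Formula.disj l) ↔ ∃ a ∈ l, Forces U w a := by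
  induction l with
  | nil => exact absurd rfl hl
  | cons a l ih =>
    cases l with
    | nil => simp [Formula.disj]
    | cons b l => simpa [Formula.disj, Forces] using or_congr_right (ih (List.cons_ne_nil _ _))

end Forcing

/-! ### The formulas of de Jongh -/

section JankovDeJongh

variable {W : Type*} [PartialOrder W] [Fintype W]

theorem mem_covers {w : W} (v : {v : W // w ⋖ v}) : v ∈ covers w := by
  simp [covers]

variable {X : Type*} [PartialOrder X]

variable [OrderTop W]

theorem covers_map_ne_nil {w : W} (hw : w ≠ ⊤) {β : Type*} (f : {v : W // w ⋖ v} → β) :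
    (covers w).map f ≠ [] := by
  obtain ⟨v, hv, -⟩ := exists_covBy_le_of_lt (lt_top_iff_ne_top.2 hw)
  exact List.ne_nil_of_mem (List.mem_map_of_mem (mem_covers ⟨v, hv⟩))

/-- The formula `ψ_w`. -/
noncomputable def psiStar (P : Finset ℕ) (V : ℕ → UpperSet W) (w : W) : Formula :=
  (jankovPair P V w).2

variable {P : Finset ℕ} {V : ℕ → UpperSet W} {U : ℕ → UpperSet X}

theorem jankovPair_eq (P : Finset ℕ) (V : ℕ → UpperSet W) (w : W) :
    jankovPair P V w = jankovStep P V w fun v _ => jankovPair P V v :=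
  IsWellFounded.fix_eq _ _ _

theorem forces_phiStar_top {u : X} :
    Forces U u (phiStar P V ⊤) ↔ ∀ i ∈ P, ⊤ ∈ V i → u ∈ U i := by
  rw [phiStar, jankovPair_eq, jankovStep, if_pos rfl, propVars, forces_conj_map_var]
  simp

theorem forces_disj_phiStar {w : W} (hw : w ≠ ⊤) {u : X} :
    Forces U u (Formula.disj ((covers w).map fun v => phiStar P V v.1)) ↔
      ∃ v, w ⋖ v ∧ Forces U u (phiStar P V v) := by
  rw [forces_disj U u (covers_map_ne_nil hw _)]
  simp [mem_covers]

theorem forces_psiStar {w : W} (hw : w ≠ ⊤) {u : X} :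
    Forces U u (psiStar P V w) ↔
      ∀ u', u ≤ u' → Forces U u' (phiStar P V w) → ∃ v, w ⋖ v ∧ Forces U u' (phiStar P V v) := by
  simp only [← forces_disj_phiStar hw]
  rw [psiStar, phiStar, jankovPair_eq, jankovStep, if_neg hw]
  rfl

/-- The recursive clause of `φ_w`. The hypothesis on `V` makes the disjunction
`⋁ newprop(w) ∨ ⋁ ψ_{w_i}` nonempty: if `⊤` is the only cover of `w`, it has as a disjunct a
variable that is true at `⊤` only. -/
theorem forces_phiStar (hV : ∀ v, ∃ i ∈ P, V i = UpperSet.Ici v) {w : W} (hw : w ≠ ⊤) {u : X} :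
    Forces U u (phiStar P V w) ↔ (∀ i ∈ P, w ∈ V i → u ∈ U i) ∧
      ∀ u', u ≤ u' →
        ((∃ i ∈ P, w ∉ V i ∧ (∀ v, w ⋖ v → v ∈ V i) ∧ u' ∈ U i) ∨
          ∃ v, w ⋖ v ∧ v ≠ ⊤ ∧ Forces U u' (psiStar P V v)) →
        ∃ v, w ⋖ v ∧ Forces U u' (phiStar P V v) := by
  classical
  have hne : newPropVars P V w ++
      ((covers w).filter fun v => v.1 ≠ ⊤).map (fun v => psiStar P V v.1) ≠ [] := by
    obtain ⟨v, hv, -⟩ := exists_covBy_le_of_lt (lt_top_iff_ne_top.2 hw)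
    by_cases h : ∃ v, w ⋖ v ∧ v ≠ ⊤
    · obtain ⟨v, hv, hv'⟩ := h
      refine List.append_ne_nil_of_right_ne_nil _ (List.ne_nil_of_mem (List.mem_map_of_mem
        (a := ⟨v, hv⟩) ?_))
      simp [mem_covers, hv']
    · push Not at h
      obtain ⟨i, hi, hVi⟩ := hV ⊤
      refine List.append_ne_nil_of_left_ne_nil (List.ne_nil_of_mem (List.mem_map_of_mem
        (a := i) ?_)) _
      simpa [hi, hVi, hw] using h
  simp only [← forces_disj_phiStar hw]
  have key : phiStar P V w = (Formula.conj (propVars P V w)).and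
      ((Formula.disj (newPropVars P V w ++
      ((covers w).filter fun v => v.1 ≠ ⊤).map (fun v => psiStar P V v.1))).imp
      (Formula.disj ((covers w).map fun v => phiStar P V v.1))) := by
    rw [phiStar, jankovPair_eq, jankovStep, if_neg hw]
    simp only [phiStar, psiStar]
  rw [key]
  refine and_congr ?_ (forall_congr' fun u' => imp_congr_right fun _ => imp_congr_left ?_)
  · rw [propVars, forces_conj_map_var]
    simp
  · rw [forces_disj U u' hne]
    simp [newPropVars, mem_covers, or_and_right, exists_or, Forces, and_assoc]

theorem mem_of_forces_phiStar (hV : ∀ v, ∃ i ∈ P, V i = UpperSet.Ici v) {w : W} {u : X}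
    (h : Forces U u (phiStar P V w)) {i : ℕ} (hi : i ∈ P) (hw : w ∈ V i) : u ∈ U i := by
  by_cases h' : w = ⊤
  · subst h'
    exact forces_phiStar_top.1 h i hi hw
  · exact ((forces_phiStar hV h').1 h).1 i hi hw

theorem forces_phiStar_of_covBy (hV : ∀ v, ∃ i ∈ P, V i = UpperSet.Ici v) {w v : W} {u : X}
    (hwv : w ⋖ v) (h : Forces U u (phiStar P V v)) : Forces U u (phiStar P V w) :=
  (forces_phiStar hV hwv.lt.ne_top).2
    ⟨fun _ hi hw => mem_of_forces_phiStar hV h hi ((V _).upper hwv.le hw),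
      fun _ hu _ => ⟨v, hwv, h.mono hu⟩⟩

theorem forces_phiStar_of_le (hV : ∀ v, ∃ i ∈ P, V i = UpperSet.Ici v) {w v : W} {u : X}
    (hwv : w ≤ v) (h : Forces U u (phiStar P V v)) : Forces U u (phiStar P V w) := by
  induction w using WellFoundedGT.induction with
  | ind w ih =>
    obtain rfl | hlt := hwv.eq_or_lt
    · exact h
    · obtain ⟨w', hw', hle⟩ := exists_covBy_le_of_lt hlt
      exact forces_phiStar_of_covBy hV hw' (ih w' hw'.lt hle)

/-- In the model `(W, V)` itself, `φ_w` is forced exactly at the nodes above `w`. -/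
theorem forces_phiStar_self (hV : ∀ v, ∃ i ∈ P, V i = UpperSet.Ici v) {w u : W} :
    Forces V u (phiStar P V w) ↔ w ≤ u := by
  constructor
  · intro h
    obtain ⟨i, hi, hVi⟩ := hV w
    simpa [hVi] using mem_of_forces_phiStar hV h hi (by simp [hVi])
  · intro hwu
    suffices h : Forces V w (phiStar P V w) from h.mono hwu
    clear hwu
    induction w using WellFoundedGT.induction with
    | ind w ih =>
      by_cases hw : w = ⊤
      · subst hw
        exact forces_phiStar_top.2 fun _ _ h => h
      · refine (forces_phiStar hV hw).2 ⟨fun _ _ h => h, fun u' hu' h => ?_⟩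
        obtain rfl | hlt := hu'.eq_or_lt
        · exfalso
          obtain ⟨i, -, hi, -, hi'⟩ | ⟨v, hv, hv', hψ⟩ := h
          · exact hi hi'
          -- `ψ_v` fails at `v`, since `φ_v` holds there and the `φ` of the covers of `v` do not.
          · obtain ⟨x, hx, hφ⟩ := (forces_psiStar hv').1 hψ v hv.le (ih v hv.lt)
            obtain ⟨i, hi, hVi⟩ := hV x
            have := mem_of_forces_phiStar hV hφ hi (by simp [hVi])
            rw [hVi, UpperSet.mem_Ici_iff] at this
            exact hx.lt.not_ge this
        · obtain ⟨v, hv, hle⟩ := exists_covBy_le_of_lt hlt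
          exact ⟨v, hv, (ih v hv.lt).mono hle⟩

/-- The node `u` of the model `(X, U)` behaves like the node `w` of `(W, V)`: it forces `φ_w`, but
none of the formulas `φ_v` for the covers `v` of `w`. -/
def HasType (P : Finset ℕ) (V : ℕ → UpperSet W) (U : ℕ → UpperSet X) (w : W) (u : X) : Prop :=
  Forces U u (phiStar P V w) ∧ ∀ v, w ⋖ v → ¬ Forces U u (phiStar P V v)

theorem HasType.exists_of_covBy (hV : ∀ v, ∃ i ∈ P, V i = UpperSet.Ici v) {w v : W} {u : X}
    (h : HasType P V U w u) (hwv : w ⋖ v) (hv : v ≠ ⊤) : ∃ u', u ≤ u' ∧ HasType P V U v u' := by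
  have hψ : ¬ Forces U u (psiStar P V v) := fun hψ => by
    obtain ⟨v', hv', h'⟩ :=
      ((forces_phiStar hV hwv.lt.ne_top).1 h.1).2 u le_rfl (.inr ⟨v, hwv, hv, hψ⟩)
    exact h.2 v' hv' h'
  rw [forces_psiStar hv] at hψ
  push Not at hψ
  obtain ⟨u', hu, h₁, h₂⟩ := hψ
  exact ⟨u', hu, h₁, h₂⟩

theorem HasType.exists_of_le (hV : ∀ v, ∃ i ∈ P, V i = UpperSet.Ici v) {w v : W} {u : X}
    (h : HasType P V U w u) (hwv : w ≤ v) (hv : v ≠ ⊤) : ∃ u', u ≤ u' ∧ HasType P V U v u' := by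
  induction w using WellFoundedGT.induction generalizing u with
  | ind w ih =>
    obtain rfl | hlt := hwv.eq_or_lt
    · exact ⟨u, le_rfl, h⟩
    · obtain ⟨w', hw', hle⟩ := exists_covBy_le_of_lt hlt
      obtain ⟨u₁, hu₁, h₁⟩ := h.exists_of_covBy hV hw' (ne_top_of_le_ne_top hv hle)
      obtain ⟨u₂, hu₂, h₂⟩ := ih w' hw'.lt h₁ hle
      exact ⟨u₂, hu₁.trans hu₂, h₂⟩

/-- A node of type `w` forces `φ_v` for `v ≤ w` only. If it forced `φ_v` for some `v ≰ w`, then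
either this would go on at a node whose type is a cover of `w`, or all covers of `w` would be above
`v`; in the latter case the variable of `v` is in `newprop(w)`, so it is not forced. -/
theorem HasType.forces_iff (hV : ∀ v, ∃ i ∈ P, V i = UpperSet.Ici v) {w v : W} {u : X}
    (h : HasType P V U w u) : Forces U u (phiStar P V v) ↔ v ≤ w := by
  refine ⟨fun hv => ?_, fun hv => forces_phiStar_of_le hV hv h.1⟩
  induction w using WellFoundedGT.induction generalizing u with
  | ind w ih =>
    by_contra hvw
    have hw : w ≠ ⊤ := fun hw => hvw (hw ▸ le_top)
    have hcov : ∀ x, w ⋖ x → v ≤ x := fun x hx => by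
      by_cases hxt : x = ⊤
      · exact hxt ▸ le_top
      · obtain ⟨u', hu, h'⟩ := h.exists_of_covBy hV hx hxt
        exact ih x hx.lt h' (hv.mono hu)
    obtain ⟨i, hi, hVi⟩ := hV v
    obtain ⟨x, hx, h'⟩ := ((forces_phiStar hV hw).1 h.1).2 u le_rfl (.inl ⟨i, hi, by simpa [hVi],
      by simpa [hVi] using hcov, mem_of_forces_phiStar hV hv hi (by simp [hVi])⟩)
    exact h.2 x hx h'

theorem exists_hasType {w : W} {u : X} (h : Forces U u (phiStar P V w)) :
    ∃ v, HasType P V U v u := by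
  induction w using WellFoundedGT.induction with
  | ind w ih =>
    by_cases h' : ∃ v, w ⋖ v ∧ Forces U u (phiStar P V v)
    · obtain ⟨v, hv, hφ⟩ := h'
      exact ih v hv.lt hφ
    · push Not at h'
      exact ⟨w, h, h'⟩

/-- If some node of a model on `X` has the type of the root of `(W, V)`, then mapping each node to
its type, and the nodes without a type to the root, gives a monotone map onto `W`. No node needs to
have type `⊤` a priori; two different coatoms of `W` force the top node of `X` to be mapped
to `⊤`. -/
theorem HasType.isOrderImage [OrderBot W] [OrderTop X]
    (hV : ∀ v, ∃ i ∈ P, V i = UpperSet.Ici v) {c d : W} (hc : c ≠ ⊤) (hd : d ≠ ⊤)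
    (hcd : ∀ v, c ≤ v → d ≤ v → v = ⊤) {u : X} (h : HasType P V U ⊥ u) : IsOrderImage W X := by
  classical
  let f : X → W := fun x => if hx : ∃ v, HasType P V U v x then hx.choose else ⊥
  have hf : ∀ {x v}, HasType P V U v x → f x = v := fun {x v} hx => by
    have hex : ∃ v, HasType P V U v x := ⟨v, hx⟩
    have h₁ : f x = hex.choose := dif_pos hex
    rw [h₁]
    exact le_antisymm ((hx.forces_iff hV).1 hex.choose_spec.1)
      ((hex.choose_spec.forces_iff hV).1 hx.1)
  have hmono : Monotone f := fun x y hxy => by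
    by_cases hx : ∃ v, HasType P V U v x
    · obtain ⟨v, hv⟩ := hx
      obtain ⟨v', hv'⟩ := exists_hasType (hv.1.mono hxy)
      rw [hf hv, hf hv']
      exact (hv'.forces_iff hV).1 (hv.1.mono hxy)
    · have h₁ : f x = ⊥ := dif_neg hx
      rw [h₁]
      exact bot_le
  have hsurj : ∀ v, v ≠ ⊤ → ∃ x, f x = v := fun v hv => by
    obtain ⟨x, -, hx⟩ := h.exists_of_le hV bot_le hv
    exact ⟨x, hf hx⟩
  refine ⟨f, hmono, fun v => ?_⟩
  by_cases hv : v = ⊤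
  · obtain ⟨x, hx⟩ := hsurj c hc
    obtain ⟨y, hy⟩ := hsurj d hd
    exact ⟨⊤, hv ▸ hcd _ (hx ▸ hmono le_top) (hy ▸ hmono le_top)⟩
  · exact hsurj v hv

end JankovDeJongh

/-! ### The posets `𝔉_n` form an antichain -/

theorem incompRel_of_map {X Y : Type*} [PartialOrder X] [PartialOrder Y] {f : X → Y}
    (hf : Monotone f) {a b : X} (h : IncompRel (· ≤ ·) (f a) (f b)) : IncompRel (· ≤ ·) a b :=
  ⟨fun hab => h.1 (hf hab), fun hba => h.2 (hf hba)⟩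

namespace Node

variable {n m : ℕ}

theorem card_eq (n : ℕ) : Fintype.card (Node n) = 2 * n + 7 := by
  let e : Node n ≃ Option (Option (Fin (n + 3) ⊕ Fin (n + 2))) :=
    { toFun := fun
        | root => none
        | top => some none
        | x i => some (some (.inl i))
        | y i => some (some (.inr i))
      invFun := fun
        | none => root
        | some none => top
        | some (some (.inl i)) => x i
        | some (some (.inr i)) => y i
      left_inv := fun a => by cases a <;> rfl
      right_inv := fun a => by rcases a with _ | _ | _ | _ <;> rfl }
  rw [Fintype.card_congr e]
  simp
  omega

/-- For `n ≥ 1`, each `x_i` is incomparable with `y_i` (if there is one), and the only other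
incomparable pairs are `x_1, y_0` and `x_{n+2}, y_{n+1}`. -/
theorem incompRel_cases (hn : 1 ≤ n) {a b : Node n} (h : IncompRel (· ≤ ·) a b) :
    ∃ (i : Fin (n + 3)) (j : Fin (n + 2)), (a = x i ∧ b = y j ∨ a = y j ∧ b = x i) ∧
      ((i : ℕ) = j ∨ (i : ℕ) = 1 ∧ (j : ℕ) = 0 ∨ (i : ℕ) = n + 2 ∧ (j : ℕ) = n + 1) := by
  obtain ⟨h₁, h₂⟩ := h
  change ¬ le a b at h₁
  change ¬ le b a at h₂
  cases a <;> cases b <;> simp only [le, not_true_eq_false] at h₁ h₂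
  · omega
  · exact ⟨_, _, .inl ⟨rfl, rfl⟩, by omega⟩
  · exact ⟨_, _, .inr ⟨rfl, rfl⟩, by omega⟩
  · omega

/-- Among the incomparable pairs, the only path `a, b, c, d` with four nodes is
`x_0, y_0, x_1, y_1`, up to reversal. The condition `a ≰ d` excludes the reversed path, since
`y_1 < x_0`. -/
theorem eq_of_path (hn : 1 ≤ n) {a b c d : Node n} (hab : IncompRel (· ≤ ·) a b)
    (hbc : IncompRel (· ≤ ·) b c) (hcd : IncompRel (· ≤ ·) c d) (hac : a ≠ c) (hbd : b ≠ d)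
    (had : ¬ a ≤ d) : b = y 0 ∧ c = x 1 ∧ d = y 1 := by
  have h0 : ((0 : Fin (n + 2)) : ℕ) = 0 := rfl
  have h1 : ((1 : Fin (n + 2)) : ℕ) = 1 := Fin.val_one _
  have h1' : ((1 : Fin (n + 3)) : ℕ) = 1 := Fin.val_one _
  obtain ⟨i₁, j₁, ⟨rfl, rfl⟩ | ⟨rfl, rfl⟩, h₁⟩ := incompRel_cases hn hab <;>
  obtain ⟨i₂, j₂, ⟨hb, rfl⟩ | ⟨hb, rfl⟩, h₂⟩ := incompRel_cases hn hbc <;>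
  obtain ⟨i₃, j₃, ⟨hc, rfl⟩ | ⟨hc, rfl⟩, h₃⟩ := incompRel_cases hn hcd <;>
  change ¬ le _ _ at had <;>
  simp only [x.injEq, y.injEq, Fin.ext_iff, ne_eq, reduceCtorEq, le] at * <;> omega

theorem eq_of_incompRel_of_incompRel (hn : 1 ≤ n) {a b c : Node n}
    (hab : IncompRel (· ≤ ·) a b) (hac : IncompRel (· ≤ ·) a c) (hbc : b ≠ c) :
    a = y 0 ∨ a = x 1 ∨ a = y (Fin.last _) ∧ ∃ i : Fin (n + 3), n + 1 ≤ (i : ℕ) ∧ b = x i := by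
  have h0 : ((0 : Fin (n + 2)) : ℕ) = 0 := rfl
  have h1 : ((1 : Fin (n + 3)) : ℕ) = 1 := Fin.val_one _
  obtain ⟨i₁, j₁, ⟨rfl, rfl⟩ | ⟨rfl, rfl⟩, h₁⟩ := incompRel_cases hn hab <;>
  obtain ⟨i₂, j₂, ⟨hb, rfl⟩ | ⟨hb, rfl⟩, h₂⟩ := incompRel_cases hn hac <;>
  simp only [x.injEq, y.injEq, Fin.ext_iff, ne_eq, reduceCtorEq, false_or, or_false, false_and,
    Fin.val_last] at *
  · omega
  · by_cases h : (j₁ : ℕ) = 0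
    · exact .inl h
    · exact .inr ⟨by omega, i₁, by omega, rfl⟩

theorem not_incompRel_three (hn : 1 ≤ n) {a b c d : Node n}
    (hab : IncompRel (· ≤ ·) a b) (hac : IncompRel (· ≤ ·) a c) (had : IncompRel (· ≤ ·) a d)
    (hbc : b ≠ c) (hbd : b ≠ d) (hcd : c ≠ d) : False := by
  obtain ⟨i₁, j₁, ⟨rfl, rfl⟩ | ⟨rfl, rfl⟩, h₁⟩ := incompRel_cases hn hab <;>
  obtain ⟨i₂, j₂, ⟨hb, rfl⟩ | ⟨hb, rfl⟩, h₂⟩ := incompRel_cases hn hac <;>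
  obtain ⟨i₃, j₃, ⟨hc, rfl⟩ | ⟨hc, rfl⟩, h₃⟩ := incompRel_cases hn had <;>
  simp only [x.injEq, y.injEq, Fin.ext_iff, ne_eq, reduceCtorEq] at * <;> omega

theorem le_of_surjective {f : Node m → Node n} (hsurj : Function.Surjective f) : n ≤ m := by
  have := Fintype.card_le_of_surjective f hsurj
  rw [card_eq, card_eq] at this
  omega

/-- A monotone surjection reflects incomparability. The path `x_0, y_0, x_1, y_1` therefore has to
come from the same path, and the nodes `x_{n+1}, y_{n+1}, x_{n+2}` from the corresponding nodes.
In between, a pair `x_k, y_k` has to be mapped onto a pair `x_j, y_j`, and `j` grows strictly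
with `k`, which leaves too little room if `n < m`. -/
theorem not_isOrderImage_of_lt (hnm : n < m) : ¬ IsOrderImage (Node n) (Node m) := by
  rintro ⟨f, hf, hsurj⟩
  have hm : 1 ≤ m := by omega
  choose s hs using hsurj
  have hinj : ∀ {a b}, a ≠ b → s a ≠ s b := fun {a b} hab h => hab (by rw [← hs a, h, hs])
  have hle : ∀ {a b}, ¬ le a b → ¬ s a ≤ s b := fun {a b} hab h => by
    have := hf h
    rw [hs, hs] at this
    exact hab this
  have hinc : ∀ {a b}, ¬ le a b → ¬ le b a → IncompRel (· ≤ ·) (s a) (s b) :=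
    fun h₁ h₂ => ⟨hle h₁, hle h₂⟩
  obtain rfl | hn := Nat.eq_zero_or_pos n
  -- In `𝔉_0`, the node `y_0` is incomparable with `x_0`, `x_1` and `x_2`.
  · exact not_incompRel_three hm (a := s (y 0)) (b := s (x 0)) (c := s (x 1)) (d := s (x 2))
      (hinc (by simp [le]) (by simp [le])) (hinc (by simp [le]) (by simp [le]))
      (hinc (by simp [le]) (by simp [le])) (hinj (by simp)) (hinj (by simp)) (hinj (by decide))
  obtain ⟨hy0, hx1, hy1⟩ := eq_of_path hm (a := s (x 0)) (b := s (y 0)) (c := s (x 1))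
    (d := s (y 1)) (hinc (by simp [le]) (by simp [le])) (hinc (by simp [le]) (by simp [le]))
    (hinc (by simp [le]) (by simp [le])) (hinj (by simp)) (hinj (by simp))
    (hle (by simp [le]))
  have hfx1 : f (x 1) = x 1 := by rw [← hx1, hs]
  have hfy1 : f (y 1) = y 1 := by rw [← hy1, hs]
  obtain ⟨hlast, i₀, hi₀, hsx⟩ :
      s (y (Fin.last _)) = y (Fin.last _) ∧
        ∃ i : Fin (m + 3), m + 1 ≤ (i : ℕ) ∧ s (x ⟨n + 1, by omega⟩) = x i := by
    obtain h | h | h := eq_of_incompRel_of_incompRel hm (a := s (y (Fin.last (n + 1))))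
      (b := s (x ⟨n + 1, by omega⟩)) (c := s (x ⟨n + 2, by omega⟩))
      (hinc (by simp [le]) (by simp [le])) (hinc (by simp [le]) (by simp [le])) (hinj (by simp))
    · exact absurd (h.trans hy0.symm) (hinj (by simp [Fin.ext_iff]))
    · exact absurd (h.trans hx1.symm) (hinj (by simp))
    · exact h
  have key : ∀ k, 1 ≤ k → k ≤ m → ∀ (a : Fin (m + 3)) (b : Fin (m + 2)), (a : ℕ) = k →
      (b : ℕ) = k → ∃ (i : Fin (n + 3)) (j : Fin (n + 2)), (i : ℕ) = j ∧ k ≤ (i : ℕ) ∧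
        (i : ℕ) ≤ n ∧ (f (x a) = x i ∧ f (y b) = y j ∨ f (x a) = y j ∧ f (y b) = x i) := by
    intro k hk
    induction k, hk using Nat.le_induction with
    | base =>
      intro _ a b ha hb
      obtain rfl : a = 1 := Fin.ext (by simpa using ha)
      obtain rfl : b = 1 := Fin.ext (by simpa using hb)
      exact ⟨1, 1, by simp, by simp, by simpa using Nat.succ_le_of_lt hn, .inl ⟨hfx1, hfy1⟩⟩
    | succ k hk ih =>
      intro hkm a b ha hb
      obtain ⟨i, j, hij, hki, hin, hf'⟩ :=
        ih (by omega) ⟨k, by omega⟩ ⟨k, by omega⟩ rfl rfl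
      have h₁ : f (x a) ≤ f (x ⟨k, by omega⟩) := hf (show k ≤ (a : ℕ) by omega)
      have h₂ : f (x a) ≤ f (y ⟨k, by omega⟩) :=
        hf (show 1 ≤ m ∧ 2 ≤ (a : ℕ) ∧ k < (a : ℕ) ∧ k ≤ m by omega)
      have h₃ : f (x a) ≤ x i ∧ f (x a) ≤ y j := by
        obtain ⟨h, h'⟩ | ⟨h, h'⟩ := hf' <;> rw [h] at h₁ <;> rw [h'] at h₂
        exacts [⟨h₁, h₂⟩, ⟨h₂, h₁⟩]
      have h₄ : y (Fin.last _) ≤ f (x a) := by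
        rw [← hs (y (Fin.last _)), hlast]
        exact hf (show (a : ℕ) < m + 1 by omega)
      have h₅ : x ⟨n + 1, by omega⟩ ≤ f (x a) := by
        rw [← hs (x ⟨n + 1, by omega⟩), hsx]
        exact hf (show (a : ℕ) ≤ i₀ by omega)
      -- The partner of `f (x_{k+1})` can only be the image of `y_{k+1}`.
      have htwin : ∀ q, IncompRel (· ≤ ·) (f (x a)) q → f (y b) = q := fun q hq => by
        rw [← hs q] at hq ⊢
        obtain ⟨i', j', ⟨h, h'⟩ | ⟨h, h'⟩, hij'⟩ :=
          incompRel_cases hm (incompRel_of_map hf hq)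
        · rw [h']
          obtain rfl := x.inj h
          congr 2
          exact Fin.ext (by omega)
        · cases h
      obtain ⟨h₃, h₃'⟩ := h₃
      change le _ _ at h₃ h₃' h₄ h₅
      cases hq : f (x a) with
      | root => rw [hq] at h₄; exact h₄.elim
      | top => rw [hq] at h₃; exact h₃.elim
      | x c =>
        rw [hq] at h₃ h₃' h₄ h₅
        simp only [le, Fin.val_last] at h₃ h₃' h₄ h₅
        refine ⟨c, ⟨c, by omega⟩, rfl, by omega, by omega, .inl ⟨rfl, htwin _ ?_⟩⟩
        rw [hq]
        exact ⟨show ¬ le _ _ by simp [le], show ¬ le _ _ by simp [le]⟩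
      | y c =>
        rw [hq] at h₃ h₃' h₄ h₅
        simp only [le, Fin.val_last] at h₃ h₃' h₄ h₅
        refine ⟨⟨c, by omega⟩, c, rfl, by simp only; omega, by simp only; omega,
          .inr ⟨rfl, htwin _ ?_⟩⟩
        rw [hq]
        exact ⟨show ¬ le _ _ by simp [le], show ¬ le _ _ by simp [le]⟩
  obtain ⟨i, j, -, hmi, hin, -⟩ := key m hm le_rfl ⟨m, by omega⟩ ⟨m, by omega⟩ rfl rfl
  omega

theorem not_isOrderImage (h : n ≠ m) : ¬ IsOrderImage (Node n) (Node m) := by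
  intro h'
  obtain ⟨f, -, hsurj⟩ := id h'
  exact not_isOrderImage_of_lt ((le_of_surjective hsurj).lt_of_ne h) h'

end Node

/-! ### The frames `𝔉_n` refute exactly their own formula -/

theorem exists_frameVal_eq_Ici {n : ℕ} (v : Node n) :
    ∃ i ∈ Finset.Icc 1 (2 * n + 7), frameVal n i = UpperSet.Ici v := by
  refine ⟨v.code, ?_, ?_⟩
  · cases v <;> simp [Node.code] <;> omega
  · ext u
    have hinj : ∀ w : Node n, w.code = v.code ↔ w = v := fun w => by
      cases w <;> cases v <;>
        simp only [Node.code, Node.x.injEq, Node.y.injEq, Fin.ext_iff, reduceCtorEq, iff_false] <;> omega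
    simp [frameVal, hinj]

theorem Node.bot_ne_top {n : ℕ} : (⊥ : Node n) ≠ ⊤ := fun h => by cases h

theorem isOrderImage_of_not_forces_theta {n : ℕ} {X : Type*} [PartialOrder X] [OrderTop X]
    {U : ℕ → UpperSet X} {u : X} (h : ¬ Forces U u (theta n)) : IsOrderImage (Node n) X := by
  obtain ⟨u', h'⟩ : ∃ u', HasType (Finset.Icc 1 (2 * n + 7)) (frameVal n) U ⊥ u' := by
    simp only [theta, Forces] at h
    push Not at h
    obtain ⟨u', -, ⟨-, h₁⟩, -, h₂⟩ := h
    refine ⟨u', h₁, fun v hv hφ => h₂ ?_⟩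
    exact (forces_disj_phiStar Node.bot_ne_top).2 ⟨v, hv, hφ⟩
  refine h'.isOrderImage exists_frameVal_eq_Ici (c := .x 0) (d := .y 0)
    (fun h => by cases h) (fun h => by cases h) fun v hx hy => ?_
  change Node.le _ _ at hx hy
  cases v <;> simp [Node.le] at hx hy
  rfl

theorem not_forces_theta_frameVal (n : ℕ) : ¬ Forces (frameVal n) ⊥ (theta n) := by
  intro h
  obtain h | h := h ⊥ le_rfl ⟨fun _ _ h => h, (forces_phiStar_self exists_frameVal_eq_Ici).2 le_rfl⟩
  -- No node has number `0`, so the variable `0` is false everywhere.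
  · obtain ⟨v, hv, -⟩ := h
    cases v <;> simp [Node.code] at hv
  · obtain ⟨v, hv, hφ⟩ := (forces_disj_phiStar Node.bot_ne_top).1 h
    exact hv.lt.not_ge ((forces_phiStar_self exists_frameVal_eq_Ici).1 hφ)

/-- The model on `𝔉_n` with negation as the identity separates `θ(𝔉_n)` from `N` together with all
the other formulas `θ(𝔉_m)`. -/
theorem theta_notMem_logicNPlus {Γ : Set ℕ} {n : ℕ} (hn : n ∉ Γ) :
    theta n ∉ logicNPlus (theta '' Γ) := by
  intro h
  refine not_forces_theta_frameVal n (Derivable.forces h ?_ _ _)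
  rintro _ (rfl | ⟨m, hm, rfl⟩) U w
  · exact forces_axN U w
  · by_contra hθ
    exact Node.not_isOrderImage (ne_of_mem_of_not_mem hm hn) (isOrderImage_of_not_forces_theta hθ)

theorem logicNPlus_theta_injective :
    Function.Injective fun Γ : Set ℕ => logicNPlus (theta '' Γ) := by
  have hmem : ∀ (Γ : Set ℕ) (n : ℕ), theta n ∈ logicNPlus (theta '' Γ) ↔ n ∈ Γ := fun Γ n =>
    ⟨fun h => by_contra fun hn => theta_notMem_logicNPlus hn h,
      fun h => .ax (.inr (Set.mem_image_of_mem theta h))⟩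
  intro Γ₁ Γ₂ h
  ext n
  rw [← hmem Γ₁ n, ← hmem Γ₂ n]
  exact Set.ext_iff.1 h (theta n)

/-! ### The number of N-logics -/

/-- A numbering of the formulas. -/
def Formula.encode : Formula → ℕ
  | var i => Nat.pair 0 i
  | top => Nat.pair 1 0
  | and a b => Nat.pair 2 (Nat.pair a.encode b.encode)
  | or a b => Nat.pair 3 (Nat.pair a.encode b.encode)
  | imp a b => Nat.pair 4 (Nat.pair a.encode b.encode)
  | neg a => Nat.pair 5 a.encode

theorem Formula.encode_injective : Function.Injective Formula.encode := by
  intro a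
  induction a with
  | var i => intro b h; cases b <;> simp_all [encode, Nat.pair_eq_pair]
  | top => intro b h; cases b <;> simp_all [encode, Nat.pair_eq_pair]
  | and a b iha ihb =>
    intro c h
    cases c <;> simp [encode, Nat.pair_eq_pair] at h
    rw [iha h.1, ihb h.2]
  | or a b iha ihb =>
    intro c h
    cases c <;> simp [encode, Nat.pair_eq_pair] at h
    rw [iha h.1, ihb h.2]
  | imp a b iha ihb =>
    intro c h
    cases c <;> simp [encode, Nat.pair_eq_pair] at h
    rw [iha h.1, ihb h.2]
  | neg a ih =>
    intro c h
    cases c <;> simp [encode, Nat.pair_eq_pair] at h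
    rw [ih h]

theorem mk_isNLogic :
    Cardinal.mk {L : Set Formula // IsNLogic L} = Cardinal.continuum := by
  apply le_antisymm
  · calc Cardinal.mk {L : Set Formula // IsNLogic L} ≤ Cardinal.mk (Set Formula) :=
          Cardinal.mk_subtype_le _
      _ ≤ Cardinal.mk (Set ℕ) :=
          Cardinal.mk_le_of_injective (Set.image_injective.2 Formula.encode_injective)
      _ = Cardinal.continuum := Cardinal.mk_set_nat
  · rw [← Cardinal.mk_set_nat]
    refine Cardinal.mk_le_of_injective (f := fun Γ : Set ℕ => (⟨logicNPlus (theta '' Γ),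
      isNLogic_logicNPlus (Set.image_subset_iff.2 fun n _ => theta_mem_logicMPC n)⟩ :
        {L : Set Formula // IsNLogic L})) fun Γ₁ Γ₂ h => ?_
    exact logicNPlus_theta_injective (congrArg Subtype.val h)

end NLogics

/-- The posets `𝔉_n` form an antichain for order-preserving images, each `θ(𝔉_n)` is a theorem of
minimal logic, the logics `N + {θ(𝔉_n) : n ∈ Γ}` are pairwise different N-logics, and the set of all
N-logics has the cardinality of the continuum. -/
theorem theorem3p4 :
    (∀ n m : ℕ, n ≠ m → ¬ NLogics.IsOrderImage (NLogics.Node n) (NLogics.Node m)) ∧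
    (∀ n : ℕ, NLogics.theta n ∈ NLogics.logicMPC) ∧
    (∀ Γ : Set ℕ, NLogics.IsNLogic (NLogics.logicNPlus (NLogics.theta '' Γ))) ∧
    (∀ Γ₁ Γ₂ : Set ℕ, Γ₁ ≠ Γ₂ →
      NLogics.logicNPlus (NLogics.theta '' Γ₁) ≠ NLogics.logicNPlus (NLogics.theta '' Γ₂)) ∧
    Cardinal.mk {L : Set NLogics.Formula // NLogics.IsNLogic L} = Cardinal.continuum := by
  open NLogics in
  exact ⟨fun _ _ => Node.not_isOrderImage, theta_mem_logicMPC,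
    fun _ => isNLogic_logicNPlus (Set.image_subset_iff.2 fun n _ => theta_mem_logicMPC n),
    fun _ _ => logicNPlus_theta_injective.ne, mk_isNLogic⟩
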